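/- Let $G=(V,E)$ be a finite graph (parallel edges and loops allowed) whose edges have been oriented. For $v\in V$ and $e\in E$ put $[v,e]=+1$ if $e$ is oriented towards $v$, $[v,e]=-1$ if $e$ is oriented away from $v$, and $[v,e]=0$ if $e$ is not incident with $v$ or is a loop, and let $\delta(v)=\sum_{e\in E}[v,e]\,e\in\mathbb{Z}\langle E\rangle$. A $2$-cycle on $G$ is a bilinear form $d:\mathbb{Z}\langle E\rangle\times\mathbb{Z}\langle E\rangle\to\mathbb{Z}$ such that $d(e,f)=0$ whenever the edges $e,f$ share a vertex, and $d(e,\delta(v))=d(\delta(v),e)=0$ for all $e\in E$, $v\in V$. A drawing $\Gamma$ of $G$ in the plane sends each vertex to a point of $\mathbb{R}^2$ and each edge to a continuous curve in $\mathbb{R}^2$ from the point of its tail to the point of its head. It is in general position if distinct vertices are sent to distinct points, no curve passes through the point of a vertex except at its two ends, and the curves of any two nonadjacent edges (edges that share no vertex) have only finitely many common points, at each of which they cross transversally. Here two curves cross transversally at a common point if, after an ambient isotopy of the plane, they are differentiable there with linearly independent tangent vectors $a$, $b$; the sign of the crossing is $+1$ if $(a,b)$ is a positively oriented basis of $\mathbb{R}^2$,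 and $-1$ otherwise. For nonadjacent edges $f,g$ the crossing number $\mathrm{kr}_\Gamma(f,g)$ is the sum of the signs of all crossings of the curves of $f$ and $g$ (counted as pairs of parameters, and with the curve of $f$ taken first), so that $\mathrm{kr}_\Gamma(g,f)=-\mathrm{kr}_\Gamma(f,g)$. **Theorem.** If $\Gamma$ is a drawing in general position in the plane of an oriented finite graph $G$ and $d$ is a $2$-cycle on $G$, then $$\mathrm{kr}_\Gamma(d):=\sum_{f,g\in E}d(f,g)\,\mathrm{kr}_\Gamma(f,g)=0,$$ where the pairs $f,g$ that share a vertex contribute $0$, as $d(f,g)=0$ for them. -/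

import Mathlib

/-- A graph with vertex set `V` and edge set `E` whose edges have been oriented: the edge `e` runs
from `tail e` to `head e`. Parallel edges and loops are allowed. -/
structure OrientedGraph (V E : Type*) where
  tail : E → V
  head : E → V

namespace OrientedGraph

variable {V E : Type*} (G : OrientedGraph V E)

/-- `e` and `f` have a common vertex. -/
def ShareVertex (e f : E) : Prop :=
  G.tail e = G.tail f ∨ G.tail e = G.head f ∨ G.head e = G.tail f ∨ G.head e = G.head f

open Classical in
/-- The number `[v, e]`: `+1` if `e` is oriented towards `v`, `-1` if `e` is oriented from `v`,
`0` if `e` is not incident with `v` (and for a loop at `v`, where both contributions cancel). -/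
noncomputable def incidence (v : V) (e : E) : ℤ :=
  (if G.head e = v then 1 else 0) - (if G.tail e = v then 1 else 0)

/-- `δ(v) = ∑ e, [v, e] e`, an element of the free module `ℤ⟨E⟩`. -/
noncomputable def delta [Fintype E] (v : V) : E →₀ ℤ :=
  ∑ e, G.incidence v e • Finsupp.single e 1

/-- A bilinear form on `ℤ⟨E⟩` is a 2-cycle of `G` if it vanishes on pairs of edges that share a
vertex and if each `d(e, ·)` and each `d(·, e)` is a circulation. -/
structure IsTwoCycle [Fintype E] (d : LinearMap.BilinForm ℤ (E →₀ ℤ)) : Prop where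
  eq_zero_of_shareVertex : ∀ e f : E, G.ShareVertex e f →
    d (Finsupp.single e 1) (Finsupp.single f 1) = 0
  right_delta : ∀ (e : E) (v : V), d (Finsupp.single e 1) (G.delta v) = 0
  left_delta : ∀ (v : V) (e : E), d (G.delta v) (Finsupp.single e 1) = 0

end OrientedGraph

/-- An ambient isotopy of the plane, starting at the identity. (The homeomorphisms `H 1` obtained
in this way are the orientation-preserving homeomorphisms of the plane.) -/
structure PlaneIsotopy where
  H : unitInterval → ((ℝ × ℝ) ≃ₜ (ℝ × ℝ))
  continuous_H : Continuous fun p : unitInterval × (ℝ × ℝ) => H p.1 p.2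
  H_zero : ∀ x, H 0 x = x

/-- The plane curves `α` and `β`, with `α s = β t`, cross transversally at the parameters `s` and
`t`, with `β` passing from the right to the left side of `α`: up to an ambient isotopy of the plane,
they have there tangent vectors `a` and `b` that form a positively oriented basis `(a, b)` of `ℝ²`.
For curves that are differentiable at `s` and `t` the constant isotopy can be used; the isotopy
makes the notion independent of smoothness, so that smooth, polygonal and arbitrary continuous
curves are all covered. -/
def CrossesPositively (α β : ℝ → ℝ × ℝ) (s t : ℝ) : Prop :=
  α s = β t ∧ ∃ (Φ : PlaneIsotopy) (a b : ℝ × ℝ),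
    HasDerivAt (fun x => Φ.H 1 (α x)) a s ∧ HasDerivAt (fun x => Φ.H 1 (β x)) b t ∧
      0 < a.1 * b.2 - a.2 * b.1

/-- The curve `β` crosses `α` transversally from the right to the left or from the left to the
right. -/
def CrossesTransversally (α β : ℝ → ℝ × ℝ) (s t : ℝ) : Prop :=
  CrossesPositively α β s t ∨ CrossesPositively β α t s

open Classical in
/-- The sign of a transversal crossing of `α` and `β`: `+1` if `β` crosses `α` from the right to the
left, `-1` if it crosses from the left to the right (that is, if `α` crosses `β` from the right to
the left). -/
noncomputable def crossingSign (α β : ℝ → ℝ × ℝ) (s t : ℝ) : ℤ :=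
  if CrossesPositively α β s t then 1 else if CrossesPositively β α t s then -1 else 0

namespace OrientedGraph

variable {V E : Type*}

/-- A drawing of `G` in the plane: vertices are sent to points, and the edge `e` to a curve that
runs from the point of `tail e` to the point of `head e`. -/
structure Drawing (G : OrientedGraph V E) where
  point : V → ℝ × ℝ
  curve : ∀ e : E, Path (point (G.tail e)) (point (G.head e))

namespace Drawing

variable {G : OrientedGraph V E} (Γ : G.Drawing)

/-- The points that the curves of `f` and `g` have in common, each given by its parameters on the
two curves. -/
def crossings (f g : E) : Set (unitInterval × unitInterval) :=
  {p | Γ.curve f p.1 = Γ.curve g p.2}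

/-- The drawing is in general position: distinct vertices are at distinct points, no curve passes
through a vertex except at its two ends, and the curves of any two nonadjacent edges
have only finitely many points in common, at each of which they cross transversally. No condition is
imposed on self-intersections of one edge, on intersections of adjacent edges, or on several
crossings being at the same point: as crossings are counted for each pair of nonadjacent edges
separately, these play no role. -/
structure InGeneralPosition : Prop where
  point_injective : Function.Injective Γ.point
  avoids_vertices : ∀ (e : E) (t : unitInterval) (v : V),
    Γ.curve e t = Γ.point v → t = 0 ∨ t = 1
  finite_crossings : ∀ f g : E, ¬ G.ShareVertex f g → (Γ.crossings f g).Finite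
  transversal : ∀ f g : E, ¬ G.ShareVertex f g → ∀ p ∈ Γ.crossings f g,
    CrossesTransversally (Γ.curve f).extend (Γ.curve g).extend p.1 p.2

/-- The crossing number `kr_Γ(f, g)` of two nonadjacent edges: the sum of the signs of their
crossings. -/
noncomputable def kr (f g : E) : ℤ :=
  ∑ᶠ p ∈ Γ.crossings f g, crossingSign (Γ.curve f).extend (Γ.curve g).extend p.1 p.2

/-- `kr_Γ(d) = ∑_{f, g} d(f, g) kr_Γ(f, g)`. For a 2-cycle `d` the pairs of edges that share a vertex
do not contribute, as `d(f, g) = 0` for them. -/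
noncomputable def krForm [Fintype E] (d : LinearMap.BilinForm ℤ (E →₀ ℤ)) : ℤ :=
  ∑ f, ∑ g, d (Finsupp.single f 1) (Finsupp.single g 1) * Γ.kr f g

end Drawing

end OrientedGraph

open Set Filter Topology Complex

/-! Identify the plane with `ℂ`. For nonadjacent edges `f`, `g` with curves `α`, `β`, consider `F(s,
t) = β t - α s` on the unit square. Its zeros are the crossings, and general position puts them in
the interior. The variation of `log F` around the boundary is the sum of the local indices of the
zeros (`rectVar_eq_sum`). At a transversal crossing `F` behaves like the linear map with columns
`-a`, `b`, so the index is minus the sign of the crossing; an isotopy does not change it.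

On each side of the square one of the two curves rests at an end vertex. So `2πi kr(f, g)` is a
combination of the four numbers `edgeVar e v`, the variation of the logarithm along one edge seen
from an end of the other (`kr_eq_edgeVar`). For fixed `f` the first half is the difference of a
potential on `V` between the ends of `g`; for fixed `g` the second is such a difference between the
ends of `f`. Circulations are orthogonal to potential differences, so summing against `d` gives `0`.
-/

/-! ### Continuous logarithms and their variation along a path. -/

theorem exists_continuous_exp_eq {X : Type*} [TopologicalSpace X] [SimplyConnectedSpace X]
    [LocallyPathConnectedSpace X] {f : X → ℂ} (hf : Continuous f) (h0 : ∀ x, f x ≠ 0) :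
    ∃ L : X → ℂ, Continuous L ∧ ∀ x, exp (L x) = f x := by
  obtain ⟨x₀⟩ : Nonempty X := inferInstance
  obtain ⟨L, ⟨-, hL⟩, -⟩ := isCoveringMapOn_exp.existsUnique_continuousMap_lifts
    ⟨f, hf⟩ (exp_log (h0 x₀)) h0
  exact ⟨L, L.continuous, fun x => congrFun hL x⟩

theorem exists_continuousOn_exp_eq_Icc {γ : ℝ → ℂ} (hγ : Continuous γ) {a b : ℝ} (hab : a ≤ b)
    (h0 : ∀ t ∈ Icc a b, γ t ≠ 0) :
    ∃ L : ℝ → ℂ, ContinuousOn L (Icc a b) ∧ ∀ t ∈ Icc a b, exp (L t) = γ t := by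
  obtain ⟨L, hL, hexp⟩ := exists_continuous_exp_eq
    (f := fun t : ℝ => γ (projIcc a b hab t)) (by fun_prop) fun t => h0 _ (projIcc a b hab t).2
  exact ⟨L, hL.continuousOn, fun t ht => by rw [hexp, projIcc_of_mem hab ht]⟩

theorem exists_continuousOn_exp_eq_rect {F : ℝ × ℝ → ℂ} (hF : Continuous F) {a b c d : ℝ}
    (hab : a ≤ b) (hcd : c ≤ d) (h0 : ∀ p ∈ Icc a b ×ˢ Icc c d, F p ≠ 0) :
    ∃ L : ℝ × ℝ → ℂ, Continuous L ∧ ∀ p ∈ Icc a b ×ˢ Icc c d, exp (L p) = F p := by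
  obtain ⟨L, hL, hexp⟩ := exists_continuous_exp_eq
    (f := fun p : ℝ × ℝ => F (projIcc a b hab p.1, projIcc c d hcd p.2)) (by fun_prop)
    fun p => h0 _ ⟨(projIcc a b hab p.1).2, (projIcc c d hcd p.2).2⟩
  exact ⟨L, hL, fun p hp => by rw [hexp, projIcc_of_mem hab hp.1, projIcc_of_mem hcd hp.2]⟩

/-- The variation of a continuous logarithm of `γ` on `[a, b]`. -/
noncomputable def logVar (γ : ℝ → ℂ) (a b : ℝ) : ℂ :=
  open Classical in
  if h : ∃ L : ℝ → ℂ, ContinuousOn L (Icc a b) ∧ ∀ t ∈ Icc a b, exp (L t) = γ t then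
    h.choose b - h.choose a else 0

/-- Two continuous logarithms on an interval differ by a constant period of `exp`, by uniqueness of
lifts through a covering; hence the choice in `logVar` is immaterial. -/
theorem logVar_eq {γ L : ℝ → ℂ} {a b : ℝ} (hab : a ≤ b) (hL : ContinuousOn L (Icc a b))
    (hexp : ∀ t ∈ Icc a b, exp (L t) = γ t) : logVar γ a b = L b - L a := by
  have h : ∃ L : ℝ → ℂ, ContinuousOn L (Icc a b) ∧ ∀ t ∈ Icc a b, exp (L t) = γ t := ⟨L, hL, hexp⟩
  rw [logVar, dif_pos h]
  set M := h.choose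
  obtain ⟨hM, hMexp⟩ : ContinuousOn M (Icc a b) ∧ ∀ t ∈ Icc a b, exp (M t) = γ t := h.choose_spec
  have ha : a ∈ Icc a b := left_mem_Icc.2 hab
  have hconst : exp (M a - L a) = 1 := by
    rw [exp_sub, hMexp a ha, hexp a ha, div_self]
    rw [← hexp a ha]
    exact exp_ne_zero _
  have key := isCoveringMap_exp.eqOn_of_comp_eqOn isPreconnected_Icc hM
    (hL.add (continuousOn_const (c := M a - L a))) (fun t ht => Subtype.ext (by
      simp only [Function.comp_apply, Pi.add_apply, exp_add, hconst, mul_one, hMexp t ht, hexp t ht])) ha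
    (by simp)
  rw [key (right_mem_Icc.2 hab)]
  simp only [Pi.add_apply]
  ring

theorem logVar_add {γ : ℝ → ℂ} (hγ : Continuous γ) {a b c : ℝ} (hab : a ≤ b) (hbc : b ≤ c)
    (h0 : ∀ t ∈ Icc a c, γ t ≠ 0) : logVar γ a c = logVar γ a b + logVar γ b c := by
  obtain ⟨L, hL, hexp⟩ := exists_continuousOn_exp_eq_Icc hγ (hab.trans hbc) h0
  rw [logVar_eq (hab.trans hbc) hL hexp,
    logVar_eq hab (hL.mono (Icc_subset_Icc_right hbc))
      fun t ht => hexp t (Icc_subset_Icc_right hbc ht),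
    logVar_eq hbc (hL.mono (Icc_subset_Icc_left hab))
      fun t ht => hexp t (Icc_subset_Icc_left hab ht)]
  ring

theorem logVar_neg {γ : ℝ → ℂ} (hγ : Continuous γ) {a b : ℝ} (hab : a ≤ b)
    (h0 : ∀ t ∈ Icc a b, γ t ≠ 0) : logVar (fun t => -γ t) a b = logVar γ a b := by
  obtain ⟨L, hL, hexp⟩ := exists_continuousOn_exp_eq_Icc hγ hab h0
  rw [logVar_eq hab hL hexp, logVar_eq (L := fun t => L t + Real.pi * I) hab (by fun_prop)
    fun t ht => by rw [exp_add, hexp t ht, exp_pi_mul_I]; ring]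
  ring

/-- Along a straight segment from `p` to `q` that is not on a line through `0`. -/
theorem logVar_segment {γ : ℝ → ℂ} {a b : ℝ} (hab : a < b) {p q : ℂ}
    (hγ : ∀ t ∈ Icc a b, γ t = p + ((t - a) / (b - a) : ℝ) * (q - p))
    (hp : p ≠ 0) (hq : (q / p).im ≠ 0) : logVar γ a b = log (q / p) := by
  -- After division by `p` the segment starts at `1` and then has nonzero imaginary part, so it
  -- avoids the cut of the principal logarithm.
  have hslit : ∀ t ∈ Icc a b, 1 + ((t - a) / (b - a) : ℝ) * (q / p - 1) ∈ slitPlane := by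
    intro t ht
    rw [mem_slitPlane_iff]
    generalize (t - a) / (b - a) = r
    rcases eq_or_ne r 0 with h | h
    · left; simp [h]
    · right
      simpa [h] using mul_ne_zero h hq
  have h1 : (b - a) / (b - a) = 1 := div_self (sub_pos.2 hab).ne'
  rw [logVar_eq (L := fun t => log p + log (1 + ((t - a) / (b - a) : ℝ) * (q / p - 1))) hab.le]
  · simp only [h1]
    simp
  · refine continuousOn_const.add (ContinuousOn.clog ?_ hslit)
    exact Continuous.continuousOn (by fun_prop)
  · intro t ht
    rw [exp_add, exp_log hp, exp_log (slitPlane_ne_zero (hslit t ht)), hγ t ht]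
    field_simp

/-! ### Winding around a rectangle: vanishing, additivity, homotopy invariance. -/

/-- The variation of the logarithm of `F` around the boundary of `[a, b] × [c, d]`. -/
noncomputable def rectVar (F : ℝ × ℝ → ℂ) (a b c d : ℝ) : ℂ :=
  logVar (fun s => F (s, c)) a b + logVar (fun t => F (b, t)) c d
    - logVar (fun s => F (s, d)) a b - logVar (fun t => F (a, t)) c d

theorem rectVar_eq_zero {F : ℝ × ℝ → ℂ} (hF : Continuous F) {a b c d : ℝ}
    (hab : a ≤ b) (hcd : c ≤ d) (h0 : ∀ p ∈ Icc a b ×ˢ Icc c d, F p ≠ 0) :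
    rectVar F a b c d = 0 := by
  obtain ⟨L, hL, hexp⟩ := exists_continuousOn_exp_eq_rect hF hab hcd h0
  have hor : ∀ t ∈ Icc c d, logVar (fun s => F (s, t)) a b = L (b, t) - L (a, t) := fun t ht =>
    logVar_eq (L := fun s => L (s, t)) hab (Continuous.continuousOn (by fun_prop))
      fun s hs => hexp (s, t) ⟨hs, ht⟩
  have ver : ∀ s ∈ Icc a b, logVar (fun t => F (s, t)) c d = L (s, d) - L (s, c) := fun s hs =>
    logVar_eq (L := fun t => L (s, t)) hcd (Continuous.continuousOn (by fun_prop))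
      fun t ht => hexp (s, t) ⟨hs, ht⟩
  rw [rectVar, hor c (left_mem_Icc.2 hcd), hor d (right_mem_Icc.2 hcd), ver a (left_mem_Icc.2 hab),
    ver b (right_mem_Icc.2 hab)]
  ring

theorem rectVar_split_left {F : ℝ × ℝ → ℂ} (hF : Continuous F) {a m b c d : ℝ}
    (ham : a ≤ m) (hmb : m ≤ b) (hc : ∀ s ∈ Icc a b, F (s, c) ≠ 0)
    (hd : ∀ s ∈ Icc a b, F (s, d) ≠ 0) :
    rectVar F a b c d = rectVar F a m c d + rectVar F m b c d := by
  rw [rectVar, rectVar, rectVar, logVar_add (by fun_prop) ham hmb hc,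
    logVar_add (by fun_prop) ham hmb hd]
  ring

theorem rectVar_split_right {F : ℝ × ℝ → ℂ} (hF : Continuous F) {a b c m d : ℝ}
    (hcm : c ≤ m) (hmd : m ≤ d) (ha : ∀ t ∈ Icc c d, F (a, t) ≠ 0)
    (hb : ∀ t ∈ Icc c d, F (b, t) ≠ 0) :
    rectVar F a b c d = rectVar F a b c m + rectVar F a b m d := by
  rw [rectVar, rectVar, rectVar, logVar_add (by fun_prop) hcm hmd ha,
    logVar_add (by fun_prop) hcm hmd hb]
  ring

/-- The four sides of the rectangle `[a, b] × [c, d]`. -/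
def rectBoundary (a b c d : ℝ) : Set (ℝ × ℝ) :=
  {p | p ∈ Icc a b ×ˢ Icc c d ∧ (p.1 = a ∨ p.1 = b ∨ p.2 = c ∨ p.2 = d)}

/-- Each side times the homotopy interval is a zero-free rectangle, so its own boundary variation is
`0`. In the sum of these four relations the variations along the corners cancel. -/
theorem rectVar_eq_of_homotopy {K : ℝ → ℝ × ℝ → ℂ} (hK : Continuous fun q : ℝ × (ℝ × ℝ) => K q.1 q.2)
    {a b c d : ℝ} (hab : a ≤ b) (hcd : c ≤ d)
    (h0 : ∀ u ∈ Icc (0 : ℝ) 1, ∀ p ∈ rectBoundary a b c d, K u p ≠ 0) :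
    rectVar (K 0) a b c d = rectVar (K 1) a b c d := by
  have hor : ∀ t ∈ Icc c d, (t = c ∨ t = d) → rectVar (fun q => K q.2 (q.1, t)) a b 0 1 = 0 :=
    fun t ht h => rectVar_eq_zero
      (hK.comp (by fun_prop : Continuous fun q : ℝ × ℝ => (q.2, (q.1, t)))) hab zero_le_one
      fun q hq => h0 q.2 hq.2 _ ⟨⟨hq.1, ht⟩, by tauto⟩
  have ver : ∀ s ∈ Icc a b, (s = a ∨ s = b) → rectVar (fun q => K q.2 (s, q.1)) c d 0 1 = 0 :=
    fun s hs h => rectVar_eq_zero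
      (hK.comp (by fun_prop : Continuous fun q : ℝ × ℝ => (q.2, (s, q.1)))) hcd zero_le_one
      fun q hq => h0 q.2 hq.2 _ ⟨⟨hs, hq.1⟩, by tauto⟩
  have h1 := hor c (left_mem_Icc.2 hcd) (.inl rfl)
  have h2 := hor d (right_mem_Icc.2 hcd) (.inr rfl)
  have h3 := ver a (left_mem_Icc.2 hab) (.inl rfl)
  have h4 := ver b (right_mem_Icc.2 hab) (.inr rfl)
  simp only [rectVar] at h1 h2 h3 h4 ⊢
  linear_combination h1 + h4 - h2 - h3

/-- As in Rouché's theorem, the straight-line homotopy from `F` to `G` has no zero on the boundary.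
-/
theorem rectVar_eq_of_norm_sub_lt {F G : ℝ × ℝ → ℂ} (hF : Continuous F) (hG : Continuous G)
    {a b c d : ℝ} (hab : a ≤ b) (hcd : c ≤ d)
    (h : ∀ p ∈ rectBoundary a b c d, ‖F p - G p‖ < ‖G p‖) :
    rectVar F a b c d = rectVar G a b c d := by
  have key := rectVar_eq_of_homotopy (K := fun u p => F p + u * (G p - F p)) (by fun_prop) hab hcd
    fun u hu p hp h0 => by
      have h1 : G p = -((1 - u : ℝ) * (F p - G p)) := by push_cast; linear_combination h0
      have h2 : ‖G p‖ = (1 - u) * ‖F p - G p‖ := by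
        conv_lhs => rw [h1, norm_neg, norm_mul, norm_real, Real.norm_of_nonneg (by linarith [hu.2])]
      nlinarith [h p hp, norm_nonneg (F p - G p), hu.1]
  simpa using key

/-! ### The index at a transversal zero. -/

theorem two_mul_log_sub_log_neg {z : ℂ} (hz : z.im ≠ 0) :
    2 * (log z - log (-z)) = 2 * Real.pi * I * (SignType.sign z.im : ℂ) := by
  have hlog : log z - log (-z) = ((arg z - arg (-z) : ℝ) : ℂ) * I := by
    rw [log, log, norm_neg]
    push_cast
    ring
  rw [hlog]
  rcases lt_or_gt_of_ne hz with h | h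
  · rw [arg_neg_eq_arg_add_pi_of_im_neg h, sign_neg h, SignType.coe_neg, SignType.coe_one]
    push_cast
    ring
  · rw [arg_neg_eq_arg_sub_pi_of_im_pos h, sign_pos h, SignType.coe_one]
    push_cast
    ring

/-- At the corners of the square the values are `±r(b - a)` and `±r(a + b)`. With `z = (a + b)/(b -
a)` the sides contribute principal logarithms of `±z` and `±z⁻¹`, which add up to `2(log z -
log(-z))`. The minus sign arises because the determinant of the columns `-a`, `b` is opposite to
that of `a`, `b`. -/
theorem rectVar_linear {a b : ℂ} (hab : a.re * b.im - a.im * b.re ≠ 0) (s t : ℝ) {r : ℝ}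
    (hr : 0 < r) :
    rectVar (fun p => (p.2 - t : ℝ) * b - (p.1 - s : ℝ) * a) (s - r) (s + r) (t - r) (t + r) =
      -(2 * Real.pi * I) * (SignType.sign (a.re * b.im - a.im * b.re) : ℂ) := by
  have hsub : b - a ≠ 0 := fun h => hab (by rw [sub_eq_zero.1 h]; ring)
  have hadd : a + b ≠ 0 := fun h => hab (by rw [eq_neg_of_add_eq_zero_right h]; simp; ring)
  have hrC : (r : ℂ) ≠ 0 := ofReal_ne_zero.2 hr.ne'
  have hN : 0 < normSq (b - a) := normSq_pos.2 hsub
  set z : ℂ := (a + b) / (b - a) with hz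
  have him : z.im = -(2 / normSq (b - a)) * (a.re * b.im - a.im * b.re) := by
    rw [hz, div_im]
    simp only [add_im, add_re, sub_im, sub_re]
    ring
  have hz0 : z ≠ 0 := div_ne_zero hadd hsub
  have hzim : z.im ≠ 0 := by
    rw [him]
    exact mul_ne_zero (neg_ne_zero.2 (by positivity)) hab
  have hsign : SignType.sign z.im = -SignType.sign (a.re * b.im - a.im * b.re) := by
    rw [him, neg_mul, Left.sign_neg, sign_mul, sign_pos (by positivity), one_mul]
  have him' : (z⁻¹).im ≠ 0 := by
    rw [inv_im]
    exact div_ne_zero (neg_ne_zero.2 hzim) (normSq_pos.2 hz0).ne'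
  have harg : ∀ w : ℂ, w.im ≠ 0 → log w⁻¹ = -log w := fun w hw =>
    log_inv _ fun h => hw (arg_eq_pi_iff.1 h).2
  have h1 : logVar (fun x : ℝ => ((t - r - t : ℝ) : ℂ) * b - (x - s : ℝ) * a) (s - r) (s + r)
      = log z := by
    have e : -((r : ℂ) * (a + b)) / -(r * (b - a)) = z := by rw [hz]; field_simp
    rw [logVar_segment (by linarith) (p := -(r * (b - a))) (q := -(r * (a + b))), e]
    · intro x _
      push_cast
      have : ((s : ℂ) + r - (s - r)) ≠ 0 := by ring_nf; simpa using hrC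
      field_simp
      ring
    · exact neg_ne_zero.2 (mul_ne_zero hrC hsub)
    · rwa [e]
  have h2 : logVar (fun x : ℝ => ((x - t : ℝ) : ℂ) * b - (s + r - s : ℝ) * a) (t - r) (t + r)
      = log (-z⁻¹) := by
    have e : (r : ℂ) * (b - a) / -(r * (a + b)) = -z⁻¹ := by rw [hz]; field_simp
    rw [logVar_segment (by linarith) (p := -(r * (a + b))) (q := r * (b - a)), e]
    · intro x _
      push_cast
      have : ((t : ℂ) + r - (t - r)) ≠ 0 := by ring_nf; simpa using hrC
      field_simp
      ring
    · exact neg_ne_zero.2 (mul_ne_zero hrC hadd)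
    · rw [e, neg_im]
      exact neg_ne_zero.2 him'
  have h3 : logVar (fun x : ℝ => ((t + r - t : ℝ) : ℂ) * b - (x - s : ℝ) * a) (s - r) (s + r)
      = log z⁻¹ := by
    have e : (r : ℂ) * (b - a) / (r * (a + b)) = z⁻¹ := by rw [hz]; field_simp
    rw [logVar_segment (by linarith) (p := r * (a + b)) (q := r * (b - a)), e]
    · intro x _
      push_cast
      have : ((s : ℂ) + r - (s - r)) ≠ 0 := by ring_nf; simpa using hrC
      field_simp
      ring
    · exact mul_ne_zero hrC hadd
    · rwa [e]
  have h4 : logVar (fun x : ℝ => ((x - t : ℝ) : ℂ) * b - (s - r - s : ℝ) * a) (t - r) (t + r)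
      = log (-z) := by
    have e : (r : ℂ) * (a + b) / -(r * (b - a)) = -z := by rw [hz]; field_simp
    rw [logVar_segment (by linarith) (p := -(r * (b - a))) (q := r * (a + b)), e]
    · intro x _
      push_cast
      have : ((t : ℂ) + r - (t - r)) ≠ 0 := by ring_nf; simpa using hrC
      field_simp
      ring
    · exact neg_ne_zero.2 (mul_ne_zero hrC hsub)
    · rw [e, neg_im]
      exact neg_ne_zero.2 hzim
  have hneg : log (-z⁻¹) = -log (-z) := by
    rw [← inv_neg, harg _ (by rw [neg_im]; exact neg_ne_zero.2 hzim)]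
  have key := two_mul_log_sub_log_neg hzim
  rw [hsign, SignType.coe_neg] at key
  rw [rectVar, h1, h2, h3, h4, hneg, harg z hzim]
  linear_combination key

theorem abs_cross_le (u v : ℂ) : |u.re * v.im - u.im * v.re| ≤ ‖u‖ * ‖v‖ := by
  have h := abs_im_le_norm ((starRingEnd ℂ) u * v)
  rw [norm_mul, norm_conj, mul_im, conj_re, conj_im] at h
  convert h using 2
  ring

theorem mem_rectBoundary_square {s t r : ℝ} {p : ℝ × ℝ}
    (hp : p ∈ rectBoundary (s - r) (s + r) (t - r) (t + r)) :
    |p.1 - s| ≤ r ∧ |p.2 - t| ≤ r ∧ (|p.1 - s| = r ∨ |p.2 - t| = r) := by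
  obtain ⟨⟨⟨h1, h2⟩, h3, h4⟩, h⟩ := hp
  have hr : 0 ≤ r := by linarith
  refine ⟨abs_le.2 ⟨by linarith, by linarith⟩, abs_le.2 ⟨by linarith, by linarith⟩, ?_⟩
  rcases h with h | h | h | h
  · left; rw [h, sub_sub_cancel_left, abs_neg, abs_of_nonneg hr]
  · left; rw [h, add_sub_cancel_left, abs_of_nonneg hr]
  · right; rw [h, sub_sub_cancel_left, abs_neg, abs_of_nonneg hr]
  · right; rw [h, add_sub_cancel_left, abs_of_nonneg hr]

theorem eventually_abs_sub_le {p : ℝ → Prop} {s : ℝ} (h : ∀ᶠ x in 𝓝 s, p x) :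
    ∀ᶠ r in 𝓝[>] (0 : ℝ), ∀ x, |x - s| ≤ r → p x := by
  obtain ⟨ε, hε, hball⟩ := Metric.eventually_nhds_iff.1 h
  filter_upwards [Ioo_mem_nhdsGT hε] with r hr x hx
  exact hball (lt_of_le_of_lt hx hr.2)

theorem eventually_rectVar_of_hasDerivAt {α β : ℝ → ℂ} (hα : Continuous α) (hβ : Continuous β)
    {s t : ℝ} {a b : ℂ} (hst : α s = β t) (ha : HasDerivAt α a s) (hb : HasDerivAt β b t)
    (hab : a.re * b.im - a.im * b.re ≠ 0) :
    ∀ᶠ r in 𝓝[>] (0 : ℝ),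
      rectVar (fun p => β p.2 - α p.1) (s - r) (s + r) (t - r) (t + r) =
        -(2 * Real.pi * I) * (SignType.sign (a.re * b.im - a.im * b.re) : ℂ) := by
  set D := |a.re * b.im - a.im * b.re| with hD
  have hDpos : 0 < D := abs_pos.2 hab
  have hM : 0 < ‖a‖ + ‖b‖ := by
    have := abs_cross_le a b
    by_contra! h
    have h1 : ‖a‖ = 0 := by linarith [norm_nonneg a, norm_nonneg b]
    rw [h1, zero_mul] at this
    exact absurd hDpos (not_lt.2 this)
  set c := D / (4 * (‖a‖ + ‖b‖)) with hc
  have hcpos : 0 < c := by positivity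
  have hcM : c * (‖a‖ + ‖b‖) = D / 4 := by rw [hc]; field_simp
  have hea := eventually_abs_sub_le ((hasDerivAt_iff_isLittleO.1 ha).bound hcpos)
  have heb := eventually_abs_sub_le ((hasDerivAt_iff_isLittleO.1 hb).bound hcpos)
  filter_upwards [hea, heb, self_mem_nhdsWithin] with r h1 h2 hr
  have hr : 0 < r := hr
  rw [← rectVar_linear hab s t hr]
  refine rectVar_eq_of_norm_sub_lt (by fun_prop) (by fun_prop) (by linarith) (by linarith) ?_
  intro p hp
  obtain ⟨hp1, hp2, hp3⟩ := mem_rectBoundary_square hp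
  have e1 := h1 _ hp1
  have e2 := h2 _ hp2
  rw [Real.norm_eq_abs] at e1 e2
  set ℓ : ℂ := (p.2 - t : ℝ) * b - (p.1 - s : ℝ) * a with hℓ
  have hle : ‖β p.2 - α p.1 - ℓ‖ ≤ 2 * c * r := by
    have : β p.2 - α p.1 - ℓ = (β p.2 - β t - (p.2 - t) • b) - (α p.1 - α s - (p.1 - s) • a) := by
      rw [hℓ, hst]
      simp only [real_smul]
      ring
    rw [this]
    refine (norm_sub_le _ _).trans ?_
    nlinarith
  -- The determinants of `ℓ` with `b` and with `a` isolate the two coordinates, one of which has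
  -- absolute value `r` on the boundary.
  have l1 : |p.1 - s| * D ≤ ‖b‖ * ‖ℓ‖ := by
    have e : b.re * ℓ.im - b.im * ℓ.re = (p.1 - s) * (a.re * b.im - a.im * b.re) := by
      simp [hℓ]
      ring
    have h := abs_cross_le b ℓ
    rwa [e, abs_mul] at h
  have l2 : |p.2 - t| * D ≤ ‖a‖ * ‖ℓ‖ := by
    have e : a.re * ℓ.im - a.im * ℓ.re = (p.2 - t) * (a.re * b.im - a.im * b.re) := by
      simp [hℓ]
      ring
    have h := abs_cross_le a ℓ
    rwa [e, abs_mul] at h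
  have l3 : r * D ≤ (‖a‖ + ‖b‖) * ‖ℓ‖ := by
    rcases hp3 with h | h
    · rw [h] at l1
      nlinarith [mul_nonneg (norm_nonneg a) (norm_nonneg ℓ)]
    · rw [h] at l2
      nlinarith [mul_nonneg (norm_nonneg b) (norm_nonneg ℓ)]
  refine lt_of_le_of_lt hle (lt_of_mul_lt_mul_left (lt_of_lt_of_le ?_ l3) hM.le)
  nlinarith

/-! ### Summing the local indices over a rectangle. -/

theorem eventually_nhdsGT_zero_ne (k : ℝ) : ∀ᶠ r in 𝓝[>] (0 : ℝ), r ≠ k := by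
  rcases lt_or_ge 0 k with h | h
  · filter_upwards [Ioo_mem_nhdsGT h] with r hr using hr.2.ne
  · filter_upwards [self_mem_nhdsWithin] with r hr using (lt_of_le_of_lt h hr).ne'

/-- The sum of the local indices of the zeros in a rectangle. -/
theorem rectVar_eq_sum {F : ℝ × ℝ → ℂ} (hF : Continuous F) (n : ℝ × ℝ → ℂ) (Z : Finset (ℝ × ℝ)) :
    ∀ {a b c d : ℝ}, a ≤ b → c ≤ d → (∀ z ∈ Z, z ∈ Ioo a b ×ˢ Ioo c d) →
      (∀ p ∈ Icc a b ×ˢ Icc c d, F p = 0 → p ∈ Z) →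
      (∀ z ∈ Z, ∀ᶠ r in 𝓝[>] (0 : ℝ), rectVar F (z.1 - r) (z.1 + r) (z.2 - r) (z.2 + r) = n z) →
      rectVar F a b c d = ∑ z ∈ Z, n z := by
  induction Z using Finset.strongInduction with
  | H Z ih =>
  intro a b c d hab hcd hZ hzero hloc
  rcases Z.eq_empty_or_nonempty with rfl | ⟨z, hz⟩
  · rw [Finset.sum_empty]
    exact rectVar_eq_zero hF hab hcd fun p hp h0 => absurd (hzero p hp h0) (Finset.notMem_empty p)
  have hsmall : ∀ k > (0 : ℝ), ∀ᶠ r in 𝓝[>] (0 : ℝ), r < k := fun k hk => by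
    filter_upwards [Ioo_mem_nhdsGT hk] with r hr using hr.2
  have hsep : ∀ᶠ r in 𝓝[>] (0 : ℝ), ∀ p ∈ Z, p ≠ z → r < |p.1 - z.1| ∨ r < |p.2 - z.2| := by
    rw [Filter.eventually_all_finset]
    intro p _
    by_cases h1 : p.1 = z.1
    · by_cases h2 : p.2 = z.2
      · exact Eventually.of_forall fun r h => absurd (Prod.ext h1 h2) h
      · filter_upwards [hsmall _ (abs_pos.2 (sub_ne_zero.2 h2))] with r hr _ using .inr hr
    · filter_upwards [hsmall _ (abs_pos.2 (sub_ne_zero.2 h1))] with r hr _ using .inl hr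
  -- Only finitely many radii put a zero on one of the lines that bound the small square around `z`.
  have hline : ∀ᶠ r in 𝓝[>] (0 : ℝ), ∀ p ∈ Z, r ≠ |p.1 - z.1| ∧ r ≠ |p.2 - z.2| := by
    rw [Filter.eventually_all_finset]
    exact fun p _ => (eventually_nhdsGT_zero_ne _).and (eventually_nhdsGT_zero_ne _)
  obtain ⟨⟨za, zb⟩, zc, zd⟩ := hZ z hz
  obtain ⟨r, hr, hn, hsep, hline, ra, rb, rc, rd⟩ :=
    ((eventually_mem_nhdsWithin (a := (0 : ℝ)) (s := Ioi 0)).and <| (hloc z hz).and <| hsep.and <|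
      hline.and <| (hsmall _ (sub_pos.2 za)).and <| (hsmall _ (sub_pos.2 zb)).and <|
      (hsmall _ (sub_pos.2 zc)).and (hsmall _ (sub_pos.2 zd))).exists
  have hr : 0 < r := hr
  obtain ⟨x₁, hx₁⟩ : ∃ x, x = z.1 - r := ⟨_, rfl⟩
  obtain ⟨x₂, hx₂⟩ : ∃ x, x = z.1 + r := ⟨_, rfl⟩
  obtain ⟨y₁, hy₁⟩ : ∃ x, x = z.2 - r := ⟨_, rfl⟩
  obtain ⟨y₂, hy₂⟩ : ∃ x, x = z.2 + r := ⟨_, rfl⟩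
  have hne : ∀ p ∈ Z, p.1 ≠ x₁ ∧ p.1 ≠ x₂ ∧ p.2 ≠ y₁ ∧ p.2 ≠ y₂ := by
    intro p hp
    obtain ⟨h1, h2⟩ := hline p hp
    refine ⟨fun h => h1 ?_, fun h => h1 ?_, fun h => h2 ?_, fun h => h2 ?_⟩
    · rw [h, hx₁, sub_sub_cancel_left, abs_neg, abs_of_pos hr]
    · rw [h, hx₂, add_sub_cancel_left, abs_of_pos hr]
    · rw [h, hy₁, sub_sub_cancel_left, abs_neg, abs_of_pos hr]
    · rw [h, hy₂, add_sub_cancel_left, abs_of_pos hr]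
  have hsep' : ∀ p ∈ Z, p ≠ z → p.1 < x₁ ∨ x₂ < p.1 ∨ p.2 < y₁ ∨ y₂ < p.2 := by
    intro p hp hpz
    rcases hsep p hp hpz with h | h
    · rcases lt_abs.1 h with h | h
      · exact .inr (.inl (by linarith))
      · exact .inl (by linarith)
    · rcases lt_abs.1 h with h | h
      · exact .inr (.inr (.inr (by linarith)))
      · exact .inr (.inr (.inl (by linarith)))
  have ax : a < x₁ := by linarith
  have xx : x₁ < x₂ := by linarith
  have xb : x₂ < b := by linarith
  have cy : c < y₁ := by linarith
  have yy : y₁ < y₂ := by linarith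
  have yd : y₂ < d := by linarith
  have hlines : ∀ p ∈ Icc a b ×ˢ Icc c d, p.1 = x₁ ∨ p.1 = x₂ ∨ p.2 = y₁ ∨ p.2 = y₂ ∨
      p.2 = c ∨ p.2 = d → F p ≠ 0 := by
    intro p hp h h0
    have hpZ := hzero p hp h0
    obtain ⟨h1, h2, h3, h4⟩ := hne p hpZ
    have h5 := (hZ p hpZ).2.1.ne'
    have h6 := (hZ p hpZ).2.2.ne
    tauto
  -- The rectangle is cut into the small square around `z`, full-height strips to its left and
  -- right, and the blocks below and above it. The last four miss `z`, so induction applies;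
  -- indicator sums over all of `Z` let the five results be added termwise.
  have hsub : ∀ (P : ℝ × ℝ → Prop) [DecidablePred P] (a' b' c' d' : ℝ), a ≤ a' → a' ≤ b' → b' ≤ b →
      c ≤ c' → c' ≤ d' → d' ≤ d → ¬P z →
      (∀ p ∈ Z, P p → p ∈ Ioo a' b' ×ˢ Ioo c' d') →
      (∀ p ∈ Z, p ∈ Icc a' b' ×ˢ Icc c' d' → P p) →
      rectVar F a' b' c' d' = ∑ p ∈ Z, if P p then n p else 0 := by
    intro P _ a' b' c' d' ha hab' hb hc hcd' hd hPz hin hout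
    rw [← Finset.sum_filter]
    refine ih (Z.filter P) (Finset.filter_ssubset.2 ⟨z, hz, hPz⟩) hab' hcd' ?_ ?_ ?_
    · exact fun p hp => hin p (Finset.mem_filter.1 hp).1 (Finset.mem_filter.1 hp).2
    · intro p hp h0
      have hpZ := hzero p ⟨Icc_subset_Icc ha hb hp.1, Icc_subset_Icc hc hd hp.2⟩ h0
      exact Finset.mem_filter.2 ⟨hpZ, hout p hpZ hp⟩
    · exact fun p hp => hloc p (Finset.mem_filter.1 hp).1
  have hleft := hsub (fun p => p.1 < x₁) a x₁ c d le_rfl ax.le (by linarith) le_rfl hcd le_rfl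
    (by simp only [not_lt]; linarith)
    (fun p hp h => ⟨⟨(hZ p hp).1.1, h⟩, (hZ p hp).2⟩)
    (fun p hp h => lt_of_le_of_ne h.1.2 (hne p hp).1)
  have hright := hsub (fun p => x₂ < p.1) x₂ b c d (by linarith) xb.le le_rfl le_rfl hcd le_rfl
    (by simp only [not_lt]; linarith)
    (fun p hp h => ⟨⟨h, (hZ p hp).1.2⟩, (hZ p hp).2⟩)
    (fun p hp h => lt_of_le_of_ne h.1.1 (hne p hp).2.1.symm)
  have hbot := hsub (fun p => x₁ < p.1 ∧ p.1 < x₂ ∧ p.2 < y₁) x₁ x₂ c y₁ ax.le xx.le xb.le le_rfl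
    cy.le (by linarith) (fun h => by linarith [h.2.2])
    (fun p hp h => ⟨⟨h.1, h.2.1⟩, (hZ p hp).2.1, h.2.2⟩)
    (fun p hp h => ⟨lt_of_le_of_ne h.1.1 (hne p hp).1.symm, lt_of_le_of_ne h.1.2 (hne p hp).2.1,
      lt_of_le_of_ne h.2.2 (hne p hp).2.2.1⟩)
  have htop := hsub (fun p => x₁ < p.1 ∧ p.1 < x₂ ∧ y₂ < p.2) x₁ x₂ y₂ d ax.le xx.le xb.le
    (by linarith) yd.le le_rfl (fun h => by linarith [h.2.2])
    (fun p hp h => ⟨⟨h.1, h.2.1⟩, h.2.2, (hZ p hp).2.2⟩)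
    (fun p hp h => ⟨lt_of_le_of_ne h.1.1 (hne p hp).1.symm, lt_of_le_of_ne h.1.2 (hne p hp).2.1,
      lt_of_le_of_ne h.2.1 (hne p hp).2.2.2.symm⟩)
  have hmid : rectVar F x₁ x₂ y₁ y₂ = ∑ p ∈ Z, if p = z then n p else 0 := by
    rw [Finset.sum_ite_eq' Z z n, if_pos hz, hx₁, hx₂, hy₁, hy₂, hn]
  have cmem : c ∈ Icc c d := left_mem_Icc.2 hcd
  have dmem : d ∈ Icc c d := right_mem_Icc.2 hcd
  rw [rectVar_split_left hF ax.le (xx.trans xb).le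
      (fun s hs => hlines _ ⟨hs, cmem⟩ (by tauto)) (fun s hs => hlines _ ⟨hs, dmem⟩ (by tauto)),
    rectVar_split_left hF xx.le xb.le
      (fun s hs => hlines _ ⟨Icc_subset_Icc_left ax.le hs, cmem⟩ (by tauto))
      (fun s hs => hlines _ ⟨Icc_subset_Icc_left ax.le hs, dmem⟩ (by tauto)),
    rectVar_split_right (a := x₁) (b := x₂) hF cy.le (yy.trans yd).le
      (fun t ht => hlines _ ⟨⟨ax.le, (xx.trans xb).le⟩, ht⟩ (by tauto))
      (fun t ht => hlines _ ⟨⟨(ax.trans xx).le, xb.le⟩, ht⟩ (by tauto)),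
    rectVar_split_right (a := x₁) (b := x₂) hF yy.le yd.le
      (fun t ht => hlines _ ⟨⟨ax.le, (xx.trans xb).le⟩, Icc_subset_Icc_left cy.le ht⟩ (by tauto))
      (fun t ht => hlines _ ⟨⟨(ax.trans xx).le, xb.le⟩, Icc_subset_Icc_left cy.le ht⟩ (by tauto)),
    hleft, hright, hbot, htop, hmid, ← Finset.sum_add_distrib, ← Finset.sum_add_distrib,
    ← Finset.sum_add_distrib, ← Finset.sum_add_distrib]
  -- Every zero lies in exactly one of the five pieces.
  refine Finset.sum_congr rfl fun p hp => ?_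
  have hp' := hsep' p hp
  have hpne := hne p hp
  have z1 : x₁ < z.1 := by linarith
  have z2 : z.1 < x₂ := by linarith
  have z3 : y₁ < z.2 := by linarith
  have z4 : z.2 < y₂ := by linarith
  clear hlines hsub hleft hright hbot htop hmid hsep hline hne hloc hzero hZ ih hsmall hn hsep'
  by_cases hpz : p = z
  · subst hpz
    simp [z1.not_gt, z2.not_gt, z3.not_gt, z4.not_gt]
  · have hp'' := hp' hpz
    rcases lt_or_gt_of_ne hpne.1 with h1 | h1
    · simp [h1, hpz, h1.not_gt, (h1.trans xx).not_gt]
    rcases lt_or_gt_of_ne hpne.2.1 with h2 | h2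
    · rcases lt_or_gt_of_ne hpne.2.2.1 with h3 | h3
      · simp [h1, h2, h3, hpz, h1.not_gt, h2.not_gt, (h3.trans yy).not_gt]
      · have h4 : y₂ < p.2 := by
          rcases hp'' with h | h | h | h
          · exact absurd h h1.not_gt
          · exact absurd h h2.not_gt
          · exact absurd h h3.not_gt
          · exact h
        simp [h1, h2, h4, hpz, h1.not_gt, h2.not_gt, h3.not_gt]
    · simp [h2, hpz, h1.not_gt, h2.not_gt]

/-! ### The index at a topological crossing. -/

/-- Each stage of the isotopy is injective, so the difference of the moved curves stays nonzero
wherever the original curves differ. The index is therefore that of the final, differentiable stage.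
-/
theorem eventually_rectVar_of_isotopy {α β : ℝ → ℝ × ℝ} (hα : Continuous α) (hβ : Continuous β)
    {s t : ℝ} (hst : α s = β t) (Φ : PlaneIsotopy) {a b : ℝ × ℝ}
    (ha : HasDerivAt (fun x => Φ.H 1 (α x)) a s) (hb : HasDerivAt (fun x => Φ.H 1 (β x)) b t)
    (hab : a.1 * b.2 - a.2 * b.1 ≠ 0)
    (hiso : ∀ᶠ r in 𝓝[>] (0 : ℝ),
      ∀ p ∈ rectBoundary (s - r) (s + r) (t - r) (t + r), α p.1 ≠ β p.2) :
    ∀ᶠ r in 𝓝[>] (0 : ℝ),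
      rectVar (fun p => equivRealProdCLM.symm (β p.2) - equivRealProdCLM.symm (α p.1))
        (s - r) (s + r) (t - r) (t + r) =
        -(2 * Real.pi * I) * (SignType.sign (a.1 * b.2 - a.2 * b.1) : ℂ) := by
  have hΦ : Continuous fun q : ℝ × (ℝ × ℝ) => Φ.H (projIcc 0 1 zero_le_one q.1) q.2 :=
    Φ.continuous_H.comp
      (((continuous_projIcc (h := zero_le_one' ℝ)).comp continuous_fst).prodMk continuous_snd)
  have hΦ1 : Continuous (Φ.H 1) := (Φ.H 1).continuous
  have hlin := eventually_rectVar_of_hasDerivAt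
    (α := fun x => equivRealProdCLM.symm (Φ.H 1 (α x)))
    (β := fun x => equivRealProdCLM.symm (Φ.H 1 (β x))) (by fun_prop) (by fun_prop)
    (by simp only [hst])
    (equivRealProdCLM.symm.hasFDerivAt.comp_hasDerivAt s ha)
    (equivRealProdCLM.symm.hasFDerivAt.comp_hasDerivAt t hb)
    (by simpa [equivRealProdCLM_symm_apply] using hab)
  filter_upwards [hlin, hiso, self_mem_nhdsWithin] with r h1 h2 hr
  have hr : 0 < r := hr
  have hK := rectVar_eq_of_homotopy
    (K := fun u p => equivRealProdCLM.symm (Φ.H (projIcc 0 1 zero_le_one u) (β p.2))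
      - equivRealProdCLM.symm (Φ.H (projIcc 0 1 zero_le_one u) (α p.1)))
    ((equivRealProdCLM.symm.continuous.comp (hΦ.comp
        (by fun_prop : Continuous fun q : ℝ × (ℝ × ℝ) => (q.1, β q.2.2)))).sub
      (equivRealProdCLM.symm.continuous.comp (hΦ.comp
        (by fun_prop : Continuous fun q : ℝ × (ℝ × ℝ) => (q.1, α q.2.1)))))
    (a := s - r) (b := s + r) (c := t - r) (d := t + r) (by linarith) (by linarith) fun u _ p hp h =>
      h2 p hp ((Φ.H _).injective (equivRealProdCLM.symm.injective (sub_eq_zero.1 h))).symm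
  have e0 : projIcc (0 : ℝ) 1 zero_le_one 0 = 0 := projIcc_left _
  have e1 : projIcc (0 : ℝ) 1 zero_le_one 1 = 1 := projIcc_right _
  simp only [e0, e1, Φ.H_zero] at hK
  rw [hK, h1]
  simp [equivRealProdCLM_symm_apply]

/-- The sign need not be known to be well defined beforehand: whichever clause of `crossingSign`
applies, its own witness computes the index. -/
theorem eventually_rectVar_eq_crossingSign {α β : ℝ → ℝ × ℝ} (hα : Continuous α)
    (hβ : Continuous β) {s t : ℝ} (h : CrossesTransversally α β s t)
    (hiso : ∀ᶠ r in 𝓝[>] (0 : ℝ),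
      ∀ p ∈ rectBoundary (s - r) (s + r) (t - r) (t + r), α p.1 ≠ β p.2) :
    ∀ᶠ r in 𝓝[>] (0 : ℝ),
      rectVar (fun p => equivRealProdCLM.symm (β p.2) - equivRealProdCLM.symm (α p.1))
        (s - r) (s + r) (t - r) (t + r) = -(2 * Real.pi * I) * (crossingSign α β s t : ℂ) := by
  unfold crossingSign
  split_ifs with h1 h2
  · obtain ⟨hst, Φ, a, b, ha, hb, hab⟩ := h1
    have key := eventually_rectVar_of_isotopy hα hβ hst Φ ha hb hab.ne' hiso
    rw [sign_pos hab] at key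
    simpa using key
  · obtain ⟨hst, Φ, b, a, hb, ha, hab⟩ := h2
    have hneg : a.1 * b.2 - a.2 * b.1 < 0 := by linarith
    have key := eventually_rectVar_of_isotopy hα hβ hst.symm Φ ha hb hneg.ne hiso
    rw [sign_neg hneg] at key
    simpa using key
  · exact absurd h (not_or.2 ⟨h1, h2⟩)

theorem eventually_rectBoundary_avoids (Z : Finset (ℝ × ℝ)) (s t : ℝ) :
    ∀ᶠ r in 𝓝[>] (0 : ℝ), ∀ p ∈ rectBoundary (s - r) (s + r) (t - r) (t + r), p ∉ Z := by
  have hline : ∀ᶠ r in 𝓝[>] (0 : ℝ), ∀ p ∈ Z, r ≠ |p.1 - s| ∧ r ≠ |p.2 - t| := by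
    rw [Filter.eventually_all_finset]
    exact fun p _ => (eventually_nhdsGT_zero_ne _).and (eventually_nhdsGT_zero_ne _)
  filter_upwards [hline] with r hr p hp hpZ
  rcases (mem_rectBoundary_square hp).2.2 with h | h
  · exact (hr p hpZ).1 h.symm
  · exact (hr p hpZ).2 h.symm

/-! ### Two-cycles and potentials. -/

namespace OrientedGraph

variable {V E : Type*} {G : OrientedGraph V E}

/-- The difference of `φ` along `f` is `∑ v, φ v [v, f]`, so exchanging the sums leaves the
circulation condition at each vertex. As `φ` is arbitrary, it may take meaningless values at some
vertices. -/
theorem IsTwoCycle.sum_right_mul_sub_eq_zero [Fintype V] [Fintype E]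
    {d : LinearMap.BilinForm ℤ (E →₀ ℤ)} (hd : G.IsTwoCycle d) (e : E) (φ : V → ℂ) :
    ∑ f, (d (Finsupp.single e 1) (Finsupp.single f 1) : ℂ) * (φ (G.head f) - φ (G.tail f)) = 0 := by
  classical
  have h : ∀ v, ∑ f, (G.incidence v f : ℂ) * d (Finsupp.single e 1) (Finsupp.single f 1) = 0 := by
    intro v
    have := hd.right_delta e v
    rw [delta, map_sum] at this
    simp only [map_smul, smul_eq_mul] at this
    exact_mod_cast this
  have h2 : ∀ f, φ (G.head f) - φ (G.tail f) = ∑ v, φ v * (G.incidence v f : ℂ) := by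
    intro f
    simp [incidence, mul_sub, Finset.sum_sub_distrib]
  calc _ = ∑ v, φ v * ∑ f, (G.incidence v f : ℂ) *
        d (Finsupp.single e 1) (Finsupp.single f 1) := by
        simp only [h2, Finset.mul_sum]
        rw [Finset.sum_comm]
        exact Finset.sum_congr rfl fun v _ => Finset.sum_congr rfl fun f _ => by ring
    _ = 0 := by simp [h]

theorem IsTwoCycle.flip [Fintype E] {d : LinearMap.BilinForm ℤ (E →₀ ℤ)} (hd : G.IsTwoCycle d) :
    G.IsTwoCycle (LinearMap.BilinForm.flip d) where
  eq_zero_of_shareVertex e f h := by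
    rw [LinearMap.BilinForm.flip_apply]
    refine hd.eq_zero_of_shareVertex f e ?_
    simp only [ShareVertex] at h ⊢
    tauto
  right_delta e v := by rw [LinearMap.BilinForm.flip_apply, hd.left_delta]
  left_delta v e := by rw [LinearMap.BilinForm.flip_apply, hd.right_delta]

/-! ### Crossing numbers as boundary variations. -/

namespace Drawing

variable (Γ : G.Drawing)

/-- The variation of the logarithm along the curve of `e`, seen from the point of `v`. -/
noncomputable def edgeVar (e : E) (v : V) : ℂ :=
  logVar (fun s => equivRealProdCLM.symm ((Γ.curve e).extend s)
    - equivRealProdCLM.symm (Γ.point v)) 0 1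

variable {Γ}

theorem InGeneralPosition.curve_ne_point (hΓ : Γ.InGeneralPosition) {e : E} {v : V}
    (ht : G.tail e ≠ v) (hh : G.head e ≠ v) (x : unitInterval) : Γ.curve e x ≠ Γ.point v := by
  intro h
  rcases hΓ.avoids_vertices e x v h with rfl | rfl
  · exact ht (hΓ.point_injective (by rw [← h, Path.source]))
  · exact hh (hΓ.point_injective (by rw [← h, Path.target]))

theorem InGeneralPosition.mem_Ioo_of_mem_crossings (hΓ : Γ.InGeneralPosition) {f g : E}
    (hfg : ¬G.ShareVertex f g) {p : unitInterval × unitInterval} (hp : p ∈ Γ.crossings f g) :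
    ((p.1 : ℝ), (p.2 : ℝ)) ∈ Ioo (0 : ℝ) 1 ×ˢ Ioo (0 : ℝ) 1 := by
  simp only [ShareVertex, not_or] at hfg
  obtain ⟨h1, h2, h3, h4⟩ := hfg
  have hp : Γ.curve f p.1 = Γ.curve g p.2 := hp
  have a0 : p.1 ≠ 0 := fun h => hΓ.curve_ne_point (Ne.symm h1) (Ne.symm h2) p.2
    (by rw [← hp, h, Path.source])
  have a1 : p.1 ≠ 1 := fun h => hΓ.curve_ne_point (Ne.symm h3) (Ne.symm h4) p.2
    (by rw [← hp, h, Path.target])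
  have b0 : p.2 ≠ 0 := fun h => hΓ.curve_ne_point h1 h3 p.1 (by rw [hp, h, Path.source])
  have b1 : p.2 ≠ 1 := fun h => hΓ.curve_ne_point h2 h4 p.1 (by rw [hp, h, Path.target])
  exact ⟨⟨unitInterval.pos_iff_ne_zero.2 a0, unitInterval.lt_one_iff_ne_one.2 a1⟩,
    ⟨unitInterval.pos_iff_ne_zero.2 b0, unitInterval.lt_one_iff_ne_one.2 b1⟩⟩

theorem InGeneralPosition.kr_eq_rectVar (hΓ : Γ.InGeneralPosition) {f g : E}
    (hfg : ¬G.ShareVertex f g) :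
    rectVar (fun p => equivRealProdCLM.symm ((Γ.curve g).extend p.2)
      - equivRealProdCLM.symm ((Γ.curve f).extend p.1)) 0 1 0 1 =
      -(2 * Real.pi * I) * (Γ.kr f g : ℂ) := by
  have hfin := hΓ.finite_crossings f g hfg
  have hinj : Function.Injective fun p : unitInterval × unitInterval => ((p.1 : ℝ), (p.2 : ℝ)) :=
    fun p q h => Prod.ext (Subtype.ext (congrArg Prod.fst h)) (Subtype.ext (congrArg Prod.snd h))
  set Z : Finset (ℝ × ℝ) := hfin.toFinset.map ⟨_, hinj⟩ with hZ
  have hmem : ∀ p ∈ Icc (0 : ℝ) 1 ×ˢ Icc (0 : ℝ) 1,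
      (Γ.curve f).extend p.1 = (Γ.curve g).extend p.2 → p ∈ Z := by
    intro p hp h
    rw [Path.extend_apply _ hp.1, Path.extend_apply _ hp.2] at h
    exact Finset.mem_map.2 ⟨(⟨p.1, hp.1⟩, ⟨p.2, hp.2⟩), hfin.mem_toFinset.2 h, rfl⟩
  have hIoo : ∀ z ∈ Z, z ∈ Ioo (0 : ℝ) 1 ×ˢ Ioo (0 : ℝ) 1 := by
    intro z hz
    obtain ⟨p, hp, rfl⟩ := Finset.mem_map.1 hz
    exact hΓ.mem_Ioo_of_mem_crossings hfg (hfin.mem_toFinset.1 hp)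
  have hcf : Continuous (Γ.curve f).extend := (Γ.curve f).continuous_extend
  have hcg : Continuous (Γ.curve g).extend := (Γ.curve g).continuous_extend
  rw [rectVar_eq_sum (by fun_prop)
    (fun z => -(2 * Real.pi * I) *
      (crossingSign (Γ.curve f).extend (Γ.curve g).extend z.1 z.2 : ℂ)) Z zero_le_one zero_le_one
    hIoo, ← Finset.mul_sum, kr, finsum_mem_eq_finite_toFinset_sum _ hfin, hZ, Finset.sum_map]
  · push_cast
    rfl
  · exact fun p hp h => hmem p hp (equivRealProdCLM.symm.injective (sub_eq_zero.1 h)).symm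
  · intro z hz
    obtain ⟨z1, z2⟩ := hIoo z hz
    have hsmall : ∀ k > (0 : ℝ), ∀ᶠ r in 𝓝[>] (0 : ℝ), r < k := fun k hk => by
      filter_upwards [Ioo_mem_nhdsGT hk] with r hr using hr.2
    -- The square must stay inside the unit square: beyond it the extended curves are constant, and
    -- `Z` does not control their coincidences.
    have hiso : ∀ᶠ r in 𝓝[>] (0 : ℝ), ∀ p ∈ rectBoundary (z.1 - r) (z.1 + r) (z.2 - r) (z.2 + r),
        (Γ.curve f).extend p.1 ≠ (Γ.curve g).extend p.2 := by
      filter_upwards [eventually_rectBoundary_avoids Z z.1 z.2, hsmall _ z1.1, hsmall _ z2.1,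
        hsmall _ (sub_pos.2 z1.2), hsmall _ (sub_pos.2 z2.2)] with r h h1 h2 h3 h4 p hp hp0
      exact h p hp (hmem p ⟨Icc_subset_Icc (by linarith) (by linarith) hp.1.1,
        Icc_subset_Icc (by linarith) (by linarith) hp.1.2⟩ hp0)
    refine eventually_rectVar_eq_crossingSign hcf hcg ?_ hiso
    obtain ⟨p, hp, rfl⟩ := Finset.mem_map.1 hz
    exact hΓ.transversal f g hfg p (hfin.mem_toFinset.1 hp)

theorem InGeneralPosition.logVar_point_sub_curve (hΓ : Γ.InGeneralPosition) {e : E} {v : V}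
    (ht : G.tail e ≠ v) (hh : G.head e ≠ v) :
    logVar (fun s => equivRealProdCLM.symm (Γ.point v)
      - equivRealProdCLM.symm ((Γ.curve e).extend s)) 0 1 = Γ.edgeVar e v := by
  have hc : Continuous (Γ.curve e).extend := (Γ.curve e).continuous_extend
  rw [edgeVar, ← logVar_neg (by fun_prop) zero_le_one]
  · simp only [neg_sub]
  · intro t ht' h
    rw [Path.extend_apply _ ht'] at h
    exact hΓ.curve_ne_point ht hh _ (equivRealProdCLM.symm.injective (sub_eq_zero.1 h)).symm

/-- The sides `t = 0, 1` of the unit square give the views of `f` from the ends of `g`, up to a sign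
that does not affect the variation; the sides `s = 0, 1` give the views of `g` from the ends of `f`.
-/
theorem InGeneralPosition.kr_eq_edgeVar (hΓ : Γ.InGeneralPosition) {f g : E}
    (hfg : ¬G.ShareVertex f g) :
    (2 * Real.pi * I) * (Γ.kr f g : ℂ) =
      (Γ.edgeVar f (G.head g) - Γ.edgeVar f (G.tail g))
        - (Γ.edgeVar g (G.head f) - Γ.edgeVar g (G.tail f)) := by
  have h := hΓ.kr_eq_rectVar hfg
  simp only [ShareVertex, not_or] at hfg
  obtain ⟨h1, h2, h3, h4⟩ := hfg
  simp only [rectVar, Path.extend_zero, Path.extend_one] at h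
  rw [hΓ.logVar_point_sub_curve h1 h3, hΓ.logVar_point_sub_curve h2 h4] at h
  simp only [edgeVar] at h ⊢
  linear_combination h

end Drawing

end OrientedGraph

theorem theorem5p3 {V E : Type*} [Fintype V] [Fintype E] (G : OrientedGraph V E)
    (Γ : G.Drawing) (hΓ : Γ.InGeneralPosition)
    (d : LinearMap.BilinForm ℤ (E →₀ ℤ)) (hd : G.IsTwoCycle d) :
    Γ.krForm d = 0 := by
  have hpi : (2 * Real.pi * I : ℂ) ≠ 0 := two_pi_I_ne_zero
  -- For edges sharing a vertex `edgeVar` may be a default value, but there `d` vanishes. The second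
  -- half is written with the flipped form, so that one orthogonality lemma handles both.
  have hterm : ∀ f g, (2 * Real.pi * I) * ((d (Finsupp.single f 1) (Finsupp.single g 1) : ℂ)
      * (Γ.kr f g : ℂ)) =
      (d (Finsupp.single f 1) (Finsupp.single g 1) : ℂ)
        * (Γ.edgeVar f (G.head g) - Γ.edgeVar f (G.tail g))
      - (LinearMap.BilinForm.flip d (Finsupp.single g 1) (Finsupp.single f 1) : ℂ)
        * (Γ.edgeVar g (G.head f) - Γ.edgeVar g (G.tail f)) := by
    intro f g
    rw [LinearMap.BilinForm.flip_apply]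
    by_cases hfg : G.ShareVertex f g
    · simp [hd.eq_zero_of_shareVertex f g hfg]
    · linear_combination (d (Finsupp.single f 1) (Finsupp.single g 1) : ℂ) * hΓ.kr_eq_edgeVar hfg
  have key : (2 * Real.pi * I) * (Γ.krForm d : ℂ) = 0 := by
    rw [OrientedGraph.Drawing.krForm]
    push_cast
    simp only [Finset.mul_sum, hterm, Finset.sum_sub_distrib, hd.sum_right_mul_sub_eq_zero]
    rw [Finset.sum_comm]
    simp only [hd.flip.sum_right_mul_sub_eq_zero, Finset.sum_const_zero, sub_zero]
  exact_mod_cast (mul_eq_zero.1 key).resolve_left hpi
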